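/- Let $n\ge 1$, let $\gamma_n=\mathcal N(\mathbf 0,\mathbf I_n)$ be the standard Gaussian measure on $\mathbb R^n$, and let $X^n\sim\gamma_n$. For a function $f:\mathbb R^n\to(0,\infty)$ write $\|f\|_p:=(\mathbb E[f(X^n)^p])^{1/p}$ for $p>0$ and $\|f\|_0:=\exp(\mathbb E[\ln f(X^n)])$. Let $g:\mathbb R^n\to\mathbb R$ be differentiable (at every point) with $\|\nabla g(X^n)\|\le 1$ almost surely, where $\|\cdot\|$ is the Euclidean norm. Then for every $p\ge 0$, the random variables $g(X^n)$ and $\mathrm e^{p\,g(X^n)}$ are integrable (so that $\|\mathrm e^g\|_p$ is well defined and finite), and for every $r\in\mathbb R$, $$\mathbb P\{g(X^n)-\ln\|\mathrm e^g\|_p\ge r\}\le\begin{cases}\mathrm e^{-\frac12\left(r+\frac p2\right)^2}, & r\ge \frac p2,\\ \mathrm e^{-pr}, & r<\frac p2.\end{cases}$$ -/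

import Mathlib

open MeasureTheory ProbabilityTheory

/-- The (pseudo-)norm `‖f‖_p` of a positive function `f` with respect to a probability measure `μ`:
`(∫ f ^ p dμ) ^ (1 / p)` for `p ≠ 0`, and `exp (∫ ln f dμ)` for `p = 0`. -/
noncomputable def pNorm {E : Type*} [MeasurableSpace E] (μ : Measure E) (p : ℝ) (f : E → ℝ) : ℝ :=
  if p = 0 then Real.exp (∫ x, Real.log (f x) ∂μ) else (∫ x, f x ^ p ∂μ) ^ (1 / p)

/-! The gradient bound makes `g` 1-Lipschitz, and then `ln ‖e^g‖_q - q / 2` is nonincreasing in `q ≥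
0` (`cgf_le_mul_log_pNorm_add`). With `N = ln ‖e^g‖_p`, Chernoff's bound at `q ≥ p` gives the
exponent `q ((q - p) / 2 - r)`, minimal over `q ≥ p` at `q = max p (r + p / 2)`: these are the two
cases.

The monotonicity is a reverse-Hölder estimate drawn from Prékopa–Leindler. With one function equal
to the Gaussian density, that inequality becomes `TransportPL` with a quadratic cost; this form
tensorises, so dimension one suffices, and the Lipschitz bound on `g` is absorbed by the cost. -/

open scoped ENNReal Pointwise

/-! ### Prékopa–Leindler on the line. -/

/-- The one-dimensional Brunn–Minkowski inequality. -/
theorem volume_add_volume_le {A B C : Set ℝ} (hA : MeasurableSet A) (hB : MeasurableSet B)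
    (hA' : A.Nonempty) (hB' : B.Nonempty) (h : ∀ a ∈ A, ∀ b ∈ B, a + b ∈ C) :
    volume A + volume B ≤ volume C := by
  have compact_case : ∀ K L : Set ℝ, IsCompact K → IsCompact L → K.Nonempty → L.Nonempty →
      K ⊆ A → L ⊆ B → volume K + volume L ≤ volume C := by
    intro K L hK hL hK' hL' hKA hLB
    have hs : sSup K ∈ K := hK.sSup_mem hK'
    have hi : sInf L ∈ L := hL.sInf_mem hL'
    have h1 : volume K = volume ((fun x => x + sInf L) '' K) := by
      rw [Set.image_add_right, measure_preimage_add_right]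
    have h2 : volume L = volume ((fun x => sSup K + x) '' L) := by
      rw [Set.image_add_left, measure_preimage_add]
    -- Both translates lie in `K + L` and meet at most in the point `sSup K + sInf L`.
    rw [h1, h2, ← measure_union₀]
    · apply measure_mono
      rintro _ (⟨x, hx, rfl⟩ | ⟨x, hx, rfl⟩)
      · exact h _ (hKA hx) _ (hLB hi)
      · exact h _ (hKA hs) _ (hLB hx)
    · exact (hL.image (by fun_prop)).measurableSet.nullMeasurableSet
    · refine measure_mono_null (t := {sSup K + sInf L}) ?_ (by simp)
      rintro _ ⟨⟨x, hx, rfl⟩, ⟨y, hy, hxy⟩⟩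
      have e1 := le_csSup hK.bddAbove hx
      have e2 := csInf_le hL.bddBelow hy
      simp only [Set.mem_singleton_iff] at hxy ⊢
      linarith
  have approx : ∀ D : Set ℝ, MeasurableSet D → ∀ c : ℝ≥0∞,
      (∀ K ⊆ D, IsCompact K → K.Nonempty → volume K ≤ c) → volume D ≤ c := by
    intro D hD c H
    refine le_of_forall_lt fun r hr => ?_
    obtain ⟨K, hKD, hK, hrK⟩ := hD.exists_lt_isCompact hr
    exact hrK.trans_le (H K hKD hK (nonempty_of_measure_ne_zero (hrK.trans_le' zero_le).ne'))
  by_cases hC : volume C = ∞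
  · simp [hC]
  have step : ∀ K ⊆ A, IsCompact K → K.Nonempty → volume K + volume B ≤ volume C := by
    intro K hKA hK hK'
    have : volume K ≠ ∞ := hK.measure_lt_top.ne
    rw [add_comm]
    have hle : volume B ≤ volume C - volume K := approx B hB _ fun L hLB hL hL' =>
      ENNReal.le_sub_of_add_le_left this (compact_case K L hK hL hK' hL' hKA hLB)
    obtain ⟨b, hb⟩ := hB'
    have hKC : volume K ≤ volume C := by
      have := compact_case K {b} hK isCompact_singleton hK' (by simp) hKA (by simpa using hb)
      simpa using this
    exact (add_le_add_left hle _).trans (tsub_add_cancel_of_le hKC).le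
  obtain ⟨a, ha⟩ := hA'
  have hBC : volume B ≤ volume C := by
    simpa using step {a} (by simpa using ha) isCompact_singleton (by simp)
  have hle : volume A ≤ volume C - volume B := approx A hA _ fun K hKA hK hK' =>
      ENNReal.le_sub_of_add_le_right (ne_top_of_le_ne_top hC hBC) (step K hKA hK hK')
  exact (add_le_add_left hle _).trans (tsub_add_cancel_of_le hBC).le

/-- The layer cake formula for functions with values in `[0, 1]`. -/
theorem lintegral_eq_lintegral_volume_lt_of_le_one {f : ℝ → ℝ≥0∞} (hf : Measurable f)
    (hf1 : ∀ x, f x ≤ 1) :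
    ∫⁻ x, f x = ∫⁻ t in Set.Ioi (0 : ℝ), volume {x | ENNReal.ofReal t < f x} := by
  have hfin : ∀ x, f x ≠ ∞ := fun x => ne_top_of_le_ne_top ENNReal.one_ne_top (hf1 x)
  have h := lintegral_eq_lintegral_meas_lt (f := fun x => (f x).toReal) volume
    (Filter.Eventually.of_forall fun x => ENNReal.toReal_nonneg) hf.ennreal_toReal.aemeasurable
  simp only [ENNReal.ofReal_toReal (hfin _)] at h
  rw [h]
  refine setLIntegral_congr_fun measurableSet_Ioi fun t ht => ?_
  congr 1
  ext x
  simp [ENNReal.ofReal_lt_iff_lt_toReal (le_of_lt ht) (hfin x)]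

/-- Equal suprema make the superlevel sets of `f` and `k` nonempty for the same `t < 1`. Then `a •
{f > t} + b • {k > t} ⊆ {h > t}`, and Brunn–Minkowski is integrated over `t`. -/
theorem add_lintegral_le_of_iSup_eq_one {a b : ℝ} (ha : 0 < a) (hb : 0 < b) (hab : a + b = 1)
    {f k h : ℝ → ℝ≥0∞} (hf : Measurable f) (hk : Measurable k) (hh : Measurable h)
    (hf1 : (⨆ x, f x) = 1) (hk1 : (⨆ x, k x) = 1)
    (H : ∀ x y, f x ^ a * k y ^ b ≤ h (a * x + b * y)) :
    ENNReal.ofReal a * (∫⁻ x, f x) + ENNReal.ofReal b * (∫⁻ x, k x) ≤ ∫⁻ x, h x := by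
  have hfle : ∀ x, f x ≤ 1 := fun x => hf1 ▸ le_iSup f x
  have hkle : ∀ x, k x ≤ 1 := fun x => hk1 ▸ le_iSup k x
  have hmin : ∫⁻ x, min (h x) 1 ≤ ∫⁻ x, h x := lintegral_mono fun x => min_le_left _ _
  refine le_trans ?_ hmin
  rw [lintegral_eq_lintegral_volume_lt_of_le_one hf hfle,
    lintegral_eq_lintegral_volume_lt_of_le_one hk hkle,
    lintegral_eq_lintegral_volume_lt_of_le_one (hh.min measurable_const) fun x => min_le_right _ _,
    ← lintegral_const_mul' _ _ ENNReal.ofReal_ne_top,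
    ← lintegral_const_mul' _ _ ENNReal.ofReal_ne_top]
  refine (le_lintegral_add _ _).trans ?_
  refine setLIntegral_mono' measurableSet_Ioi fun t ht => ?_
  by_cases ht1 : 1 ≤ t
  · have h1 : 1 ≤ ENNReal.ofReal t := by simpa using ENNReal.ofReal_le_ofReal ht1
    have e1 : {x | ENNReal.ofReal t < f x} = ∅ := by
      ext x; simpa using (hfle x).trans h1
    have e2 : {x | ENNReal.ofReal t < k x} = ∅ := by
      ext x; simpa using (hkle x).trans h1
    simp [e1, e2]
  · have h1 : ENNReal.ofReal t < 1 := by simpa using not_le.1 ht1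
    have scale : ∀ {c : ℝ}, 0 < c → ∀ S : Set ℝ,
        ENNReal.ofReal c * volume S = volume (c • S) := by
      intro c hc S
      rw [Measure.addHaar_smul]
      simp [abs_of_pos hc]
    rw [scale ha, scale hb]
    refine volume_add_volume_le ((measurableSet_lt measurable_const hf).const_smul₀ a)
      ((measurableSet_lt measurable_const hk).const_smul₀ b) ?_ ?_ ?_
    · obtain ⟨x, hx⟩ := lt_iSup_iff.1 (hf1 ▸ h1)
      exact Set.Nonempty.smul_set ⟨x, hx⟩
    · obtain ⟨x, hx⟩ := lt_iSup_iff.1 (hk1 ▸ h1)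
      exact Set.Nonempty.smul_set ⟨x, hx⟩
    · rintro _ ⟨x, hx, rfl⟩ _ ⟨y, hy, rfl⟩
      simp only [Set.mem_ofPred_eq, smul_eq_mul] at hx hy ⊢
      have hlt := ENNReal.mul_lt_mul (ENNReal.rpow_lt_rpow hx ha) (ENNReal.rpow_lt_rpow hy hb)
      rw [← ENNReal.rpow_add_of_nonneg _ _ ha.le hb.le, hab, ENNReal.rpow_one] at hlt
      exact lt_min (hlt.trans_le (H x y)) h1

theorem ENNReal.rpow_mul_rpow_le_add {a b : ℝ} (ha : 0 < a) (hb : 0 < b) (hab : a + b = 1)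
    (x y : ℝ≥0∞) : x ^ a * y ^ b ≤ ENNReal.ofReal a * x + ENNReal.ofReal b * y := by
  have hpq : (1 / a).HolderConjugate (1 / b) := by
    rw [Real.holderConjugate_iff]
    refine ⟨?_, by simpa using hab⟩
    rw [lt_div_iff₀ ha]; linarith
  have := ENNReal.young_inequality (x ^ a) (y ^ b) hpq
  rw [← ENNReal.rpow_mul, ← ENNReal.rpow_mul, mul_one_div_cancel ha.ne',
    mul_one_div_cancel hb.ne', ENNReal.rpow_one, ENNReal.rpow_one,
    ENNReal.ofReal_div_of_pos ha, ENNReal.ofReal_div_of_pos hb] at this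
  simpa [ENNReal.div_eq_inv_mul] using this

/-- The one-dimensional Prékopa–Leindler inequality for bounded functions. -/
theorem prekopa_leindler_of_bounded {a b : ℝ} (ha : 0 < a) (hb : 0 < b) (hab : a + b = 1)
    {f k h : ℝ → ℝ≥0∞} (hf : Measurable f) (hk : Measurable k) (hh : Measurable h)
    (hfb : (⨆ x, f x) ≠ ∞) (hkb : (⨆ x, k x) ≠ ∞)
    (H : ∀ x y, f x ^ a * k y ^ b ≤ h (a * x + b * y)) :
    (∫⁻ x, f x) ^ a * (∫⁻ x, k x) ^ b ≤ ∫⁻ x, h x := by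
  set m := ⨆ x, f x
  set l := ⨆ x, k x
  by_cases hm0 : m = 0
  · have : ∀ x, f x = 0 := fun x => le_antisymm (hm0 ▸ le_iSup f x) zero_le
    simp [this, ha]
  by_cases hl0 : l = 0
  · have : ∀ x, k x = 0 := fun x => le_antisymm (hl0 ▸ le_iSup k x) zero_le
    simp [this, hb]
  have key := add_lintegral_le_of_iSup_eq_one ha hb hab (hf.const_mul m⁻¹) (hk.const_mul l⁻¹)
    (hh.const_mul (m⁻¹ ^ a * l⁻¹ ^ b))
    (by rw [← ENNReal.mul_iSup]; exact ENNReal.inv_mul_cancel hm0 hfb)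
    (by rw [← ENNReal.mul_iSup]; exact ENNReal.inv_mul_cancel hl0 hkb)
    (fun x y => by
      rw [ENNReal.mul_rpow_of_nonneg _ _ ha.le, ENNReal.mul_rpow_of_nonneg _ _ hb.le,
        mul_mul_mul_comm]
      exact mul_le_mul_right (H x y) _)
  have key2 := (ENNReal.rpow_mul_rpow_le_add ha hb hab _ _).trans key
  rw [lintegral_const_mul _ hf, lintegral_const_mul _ hk, lintegral_const_mul _ hh,
    ENNReal.mul_rpow_of_nonneg _ _ ha.le, ENNReal.mul_rpow_of_nonneg _ _ hb.le,
    mul_mul_mul_comm] at key2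
  have n0 : m⁻¹ ^ a * l⁻¹ ^ b ≠ 0 := by
    simp [ENNReal.rpow_eq_zero_iff, hfb, hkb, ha.not_gt, hb.not_gt]
  have nt : m⁻¹ ^ a * l⁻¹ ^ b ≠ ∞ := by
    apply ENNReal.mul_ne_top <;> apply ENNReal.rpow_ne_top_of_nonneg <;>
      simp [hm0, hl0, ha.le, hb.le]
  exact (ENNReal.mul_le_mul_iff_right n0 nt).1 key2

/-! ### The Gaussian transport inequality in every dimension. -/

/-- The Prékopa–Leindler inequality relative to a probability measure `μ`, with the constant
function `1` as second function and the multiplicative cost `w`. -/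
def TransportPL {E : Type*} [MeasurableSpace E] (μ : Measure E) (a : ℝ) (w : E → E → ℝ≥0∞) : Prop :=
  ∀ F H : E → ℝ≥0∞, Measurable F → Measurable H → (∀ x z, F x ^ a ≤ w x z * H z) →
    (∫⁻ x, F x ∂μ) ^ a ≤ ∫⁻ z, H z ∂μ

/-- For fixed `x`, `z`, the inequality for `ν` applied to the slices `F (x, ·)` and `w x z * H (z,
·)` is exactly the hypothesis needed for `μ` on the partial integrals. -/
theorem TransportPL.prod {E E' : Type*} [MeasurableSpace E] [MeasurableSpace E']
    {μ : Measure E} {ν : Measure E'} [SFinite ν] {a : ℝ}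
    {w : E → E → ℝ≥0∞} {w' : E' → E' → ℝ≥0∞} (hw : ∀ x z, w x z ≠ ∞)
    (hμ : TransportPL μ a w) (hν : TransportPL ν a w') :
    TransportPL (μ.prod ν) a (fun x z => w x.1 z.1 * w' x.2 z.2) := by
  intro F H hF hH h
  rw [lintegral_prod _ hF.aemeasurable, lintegral_prod _ hH.aemeasurable]
  refine hμ _ _ hF.lintegral_prod_right' hH.lintegral_prod_right' fun x z => ?_
  rw [← lintegral_const_mul' _ _ (hw x z)]
  refine hν _ _ (hF.comp measurable_prodMk_left)
    ((hH.comp measurable_prodMk_left).const_mul _) fun x' z' => ?_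
  calc F (x, x') ^ a ≤ w x z * w' x' z' * H (z, z') := h (x, x') (z, z')
    _ = w' x' z' * (w x z * H (z, z')) := by ring

theorem TransportPL.map {E E' : Type*} [MeasurableSpace E] [MeasurableSpace E']
    {μ : Measure E} {a : ℝ} {w : E → E → ℝ≥0∞} {w' : E' → E' → ℝ≥0∞}
    {φ : E → E'} (hφ : Measurable φ) (hw : ∀ x z, w' (φ x) (φ z) ≤ w x z)
    (hμ : TransportPL μ a w) : TransportPL (μ.map φ) a w' := by
  intro F H hF hH h
  rw [lintegral_map hF hφ, lintegral_map hH hφ]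
  exact hμ _ _ (hF.comp hφ) (hH.comp hφ) fun x z =>
    (h (φ x) (φ z)).trans (mul_le_mul_left (hw x z) _)

theorem transportPL_gaussianReal {a : ℝ} (ha : 0 < a) (ha1 : a < 1) :
    TransportPL (gaussianReal 0 1) a
      (fun x z => ENNReal.ofReal (Real.exp (a / (2 * (1 - a)) * (x - z) ^ 2))) := by
  intro F H hF hH h
  have hb : 0 < 1 - a := by linarith
  have hφ := measurable_gaussianPDF 0 1
  -- Truncation provides the finite supremum; monotone convergence removes it at the end.
  have bounded : ∀ n : ℕ, (∫⁻ x, min (F x) n ∂gaussianReal 0 1) ^ a ≤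
      ∫⁻ z, H z ∂gaussianReal 0 1 := by
    intro n
    rw [gaussianReal_of_var_ne_zero 0 one_ne_zero,
      lintegral_withDensity_eq_lintegral_mul _ hφ (hF.min measurable_const),
      lintegral_withDensity_eq_lintegral_mul _ hφ hH]
    have hφle : ∀ x, gaussianPDF 0 1 x ≤ ENNReal.ofReal (√(2 * Real.pi))⁻¹ := by
      intro x
      rw [gaussianPDF, gaussianPDFReal]
      refine ENNReal.ofReal_le_ofReal ?_
      simp only [NNReal.coe_one, mul_one]
      refine mul_le_of_le_one_right (by positivity) (Real.exp_le_one_iff.2 ?_)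
      have : 0 ≤ (x - 0) ^ 2 / 2 := by positivity
      linarith [neg_div 2 ((x - 0) ^ 2)]
    have := prekopa_leindler_of_bounded ha hb (by ring)
      (f := gaussianPDF 0 1 * fun x => min (F x) n) (k := gaussianPDF 0 1)
      (h := gaussianPDF 0 1 * H) (hφ.mul (hF.min measurable_const)) hφ (hφ.mul hH)
      (ne_top_of_le_ne_top (ENNReal.mul_ne_top ENNReal.ofReal_ne_top (ENNReal.natCast_ne_top n))
        (iSup_le fun x => mul_le_mul' (hφle x) (min_le_right _ _)))
      (ne_top_of_le_ne_top ENNReal.ofReal_ne_top (iSup_le hφle)) (fun x y => ?_)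
    · simpa [lintegral_gaussianPDF_eq_one] using this
    · set z := a * x + (1 - a) * y
      -- Here `a x² + (1 - a) y² = z² + a (1 - a) (x - y)²` and `x - z = (1 - a) (x - y)`, whence
      -- the constant in the cost.
      have hdens : gaussianPDF 0 1 x ^ a * gaussianPDF 0 1 y ^ (1 - a) *
          ENNReal.ofReal (Real.exp (a / (2 * (1 - a)) * (x - z) ^ 2)) = gaussianPDF 0 1 z := by
        have hc : 0 < (√(2 * Real.pi))⁻¹ := by positivity
        simp only [gaussianPDF, gaussianPDFReal, NNReal.coe_one, mul_one, sub_zero]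
        rw [ENNReal.ofReal_rpow_of_pos (by positivity), ENNReal.ofReal_rpow_of_pos (by positivity),
          ← ENNReal.ofReal_mul (by positivity), ← ENNReal.ofReal_mul (by positivity)]
        congr 1
        rw [Real.mul_rpow hc.le (Real.exp_nonneg _), Real.mul_rpow hc.le (Real.exp_nonneg _),
          ← Real.exp_mul, ← Real.exp_mul, mul_mul_mul_comm, ← Real.rpow_add hc,
          ← Real.exp_add, mul_assoc, ← Real.exp_add]
        congr 1
        · simp
        · congr 1
          simp only [z]
          field_simp
          ring
      calc (gaussianPDF 0 1 x * min (F x) n) ^ a * gaussianPDF 0 1 y ^ (1 - a)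
          ≤ gaussianPDF 0 1 x ^ a * gaussianPDF 0 1 y ^ (1 - a) * F x ^ a := by
            rw [ENNReal.mul_rpow_of_nonneg _ _ ha.le, mul_right_comm]
            gcongr
            exact min_le_left _ _
        _ ≤ gaussianPDF 0 1 x ^ a * gaussianPDF 0 1 y ^ (1 - a) *
            (ENNReal.ofReal (Real.exp (a / (2 * (1 - a)) * (x - z) ^ 2)) * H z) := by
            gcongr
            exact h x z
        _ = gaussianPDF 0 1 z * H z := by rw [← mul_assoc, hdens]
  have hsup : ∀ x, F x = ⨆ n : ℕ, min (F x) n := by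
    intro x
    rw [← inf_iSup_eq, ENNReal.iSup_natCast, inf_top_eq]
  rw [← ENNReal.le_rpow_inv_iff ha]
  conv_lhs => enter [2, x]; rw [hsup x]
  rw [lintegral_iSup (fun n => hF.min measurable_const)
    (fun m n hmn x => min_le_min_left _ (by exact_mod_cast hmn))]
  exact iSup_le fun n => (ENNReal.le_rpow_inv_iff ha).2 (bounded n)

theorem transportPL_pi_gaussianReal {a : ℝ} (ha : 0 < a) (ha1 : a < 1) (n : ℕ) :
    TransportPL (Measure.pi fun _ : Fin n => gaussianReal 0 1) a
      (fun x z => ENNReal.ofReal (Real.exp (a / (2 * (1 - a)) * ∑ i, (x i - z i) ^ 2))) := by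
  induction n with
  | zero =>
    intro F H _ _ h
    simpa [Measure.pi_of_empty _ 0] using h 0 0
  | succ n ih =>
    have hmp := (measurePreserving_piFinSuccAbove (fun _ : Fin (n + 1) => gaussianReal 0 1) 0).symm
    rw [← hmp.map_eq]
    refine ((transportPL_gaussianReal ha ha1).prod (fun _ _ => ENNReal.ofReal_ne_top) ih).map
      (MeasurableEquiv.measurable _) fun x z => le_of_eq ?_
    rw [← ENNReal.ofReal_mul (Real.exp_nonneg _), ← Real.exp_add, ← mul_add]
    simp [Fin.sum_univ_succ, MeasurableEquiv.piFinSuccAbove, Fin.insertNthEquiv]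

theorem transportPL_stdGaussian {a : ℝ} (ha : 0 < a) (ha1 : a < 1) (n : ℕ) :
    TransportPL (stdGaussian (EuclideanSpace ℝ (Fin n))) a
      (fun x z => ENNReal.ofReal (Real.exp (a / (2 * (1 - a)) * ‖x - z‖ ^ 2))) := by
  rw [← map_pi_eq_stdGaussian]
  refine (transportPL_pi_gaussianReal ha ha1 n).map (by fun_prop) fun x z => le_of_eq ?_
  simp [EuclideanSpace.real_norm_sq_eq]

/-! ### From an almost sure gradient bound to a Lipschitz bound. -/

theorem volume_pi_absolutelyContinuous_gaussianReal (n : ℕ) :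
    (volume : Measure (Fin n → ℝ)) ≪ Measure.pi fun _ : Fin n => gaussianReal 0 1 := by
  induction n with
  | zero => rw [volume_pi, Measure.pi_of_empty _ 0, Measure.pi_of_empty _ 0]
  | succ n ih =>
    have h1 := (measurePreserving_piFinSuccAbove (fun _ : Fin (n + 1) => gaussianReal 0 1) 0).symm
    have h2 := (volume_preserving_piFinSuccAbove (fun _ : Fin (n + 1) => ℝ) 0).symm
    rw [← h1.map_eq, ← h2.map_eq]
    exact ((gaussianReal_absolutelyContinuous' 0 one_ne_zero).prod ih).map
      (MeasurableEquiv.measurable _)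

theorem volume_absolutelyContinuous_stdGaussian (n : ℕ) :
    (volume : Measure (EuclideanSpace ℝ (Fin n))) ≪ stdGaussian (EuclideanSpace ℝ (Fin n)) := by
  rw [← map_pi_eq_stdGaussian, ← (PiLp.volume_preserving_toLp (Fin n)).map_eq]
  exact (volume_pi_absolutelyContinuous_gaussianReal n).map (by fun_prop)

/-- An everywhere differentiable function on the line whose derivative is almost everywhere bounded
by `C` does not increase lengths by more than the factor `C`. -/
theorem abs_sub_le_of_ae_abs_deriv_le {f : ℝ → ℝ} (hf : Differentiable ℝ f) {C : ℝ} (hC : 0 ≤ C)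
    (h : ∀ᵐ t, |deriv f t| ≤ C) {a b : ℝ} (hab : a ≤ b) : |f b - f a| ≤ C * (b - a) := by
  -- The image has length at least `|f b - f a|` and at most `∫ |f'|`, so no continuity of the
  -- derivative is needed.
  have himg : Set.uIcc (f a) (f b) ⊆ f '' Set.Icc a b := by
    have := intermediate_value_uIcc (hf.continuous.continuousOn (s := Set.uIcc a b))
    rwa [Set.uIcc_of_le hab] at this
  have h1 := addHaar_image_le_lintegral_abs_det_fderiv volume (measurableSet_Icc (a := a) (b := b))
    (f := f) (f' := fderiv ℝ f) fun x _ => (hf x).hasFDerivAt.hasFDerivWithinAt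
  have h2 : ∫⁻ x in Set.Icc a b, ENNReal.ofReal |(fderiv ℝ f x).det| ≤
      ∫⁻ _ in Set.Icc a b, ENNReal.ofReal C := by
    refine lintegral_mono_ae ((ae_restrict_of_ae h).mono fun x hx => ?_)
    refine ENNReal.ofReal_le_ofReal ?_
    have : (fderiv ℝ f x).det = deriv f x := by
      rw [← toSpanSingleton_deriv, ContinuousLinearMap.det_toSpanSingleton]
    rwa [this]
  have h3 := ((measure_mono himg).trans h1).trans h2
  rw [Real.volume_interval, setLIntegral_const, Real.volume_Icc, ← ENNReal.ofReal_mul hC,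
    ENNReal.ofReal_le_ofReal_iff (mul_nonneg hC (by linarith))] at h3
  exact h3

/-- An everywhere differentiable function on a Euclidean space whose gradient is almost everywhere
bounded by `1` is `1`-Lipschitz. -/
theorem abs_sub_le_norm_of_ae_norm_gradient_le_one {n : ℕ} {g : EuclideanSpace ℝ (Fin n) → ℝ}
    (hg : Differentiable ℝ g) (h : ∀ᵐ x, ‖gradient g x‖ ≤ 1) (x y : EuclideanSpace ℝ (Fin n)) :
    |g x - g y| ≤ ‖x - y‖ := by
  have hnorm : ∀ z, ‖gradient g z‖ = ‖fderiv ℝ g z‖ := fun z => by simp [gradient]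
  simp only [hnorm] at h
  set v := x - y with hv
  have hmeas : MeasurableSet {q : EuclideanSpace ℝ (Fin n) × ℝ |
      ‖fderiv ℝ g (q.1 + q.2 • v)‖ ≤ 1} :=
    measurableSet_le ((measurable_fderiv ℝ g).norm.comp (by fun_prop)) measurable_const
  -- By Fubini, on almost every line in direction `v` the bound holds at almost every point.
  have hprod : ∀ᵐ q ∂((volume : Measure (EuclideanSpace ℝ (Fin n))).prod (volume : Measure ℝ)),
      ‖fderiv ℝ g (q.1 + q.2 • v)‖ ≤ 1 := by
    refine (Measure.ae_prod_iff_ae_ae hmeas).2 ((Measure.ae_ae_comm hmeas).2 ?_)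
    refine Filter.Eventually.of_forall fun t => ?_
    exact (measurePreserving_add_right volume (t • v)).quasiMeasurePreserving.ae h
  have hline : ∀ᵐ z : EuclideanSpace ℝ (Fin n), |g (z + v) - g z| ≤ ‖v‖ := by
    filter_upwards [Measure.ae_ae_of_ae_prod hprod] with z hz
    have hd : ∀ t : ℝ, HasDerivAt (fun t : ℝ => g (z + t • v)) (fderiv ℝ g (z + t • v) v) t := by
      intro t
      have := ((hasDerivAt_id t).smul_const v).const_add z
      rw [one_smul] at this
      exact (hg (z + t • v)).hasFDerivAt.comp_hasDerivAt t this
    have := abs_sub_le_of_ae_abs_deriv_le (fun t => (hd t).differentiableAt) (norm_nonneg v)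
      (hz.mono fun t ht => by
        rw [(hd t).deriv, ← Real.norm_eq_abs]
        exact ((fderiv ℝ g (z + t • v)).le_of_opNorm_le ht v).trans_eq (one_mul _))
      (zero_le_one (α := ℝ))
    simpa using this
  have hall : ∀ z, |g (z + v) - g z| ≤ ‖v‖ := by
    have hclosed : IsClosed {z | |g (z + v) - g z| ≤ ‖v‖} := by
      have := hg.continuous
      exact isClosed_le (by fun_prop) continuous_const
    have hd := (Measure.dense_of_ae hline).closure_eq
    rw [hclosed.closure_eq] at hd
    exact fun z => Set.eq_univ_iff_forall.1 hd z
  simpa [hv] using hall y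

/-! ### Exponential moments and the monotonicity in `q`. -/

theorem integrable_exp_mul_of_lipschitz {n : ℕ} {g : EuclideanSpace ℝ (Fin n) → ℝ}
    (hg : Continuous g) (hlip : ∀ x y, |g x - g y| ≤ ‖x - y‖) (t : ℝ) :
    Integrable (fun x => Real.exp (t * g x)) (stdGaussian (EuclideanSpace ℝ (Fin n))) := by
  -- Fernique's theorem: `exp (C ‖x‖²)` dominates the exponential of a function of linear growth.
  obtain ⟨C, hC, hint⟩ :=
    IsGaussian.exists_integrable_exp_sq (stdGaussian (EuclideanSpace ℝ (Fin n)))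
  refine (hint.const_mul (Real.exp (|t| * |g 0| + t ^ 2 / (4 * C)))).mono'
    (by fun_prop) (Filter.Eventually.of_forall fun x => ?_)
  rw [Real.norm_of_nonneg (Real.exp_nonneg _), ← Real.exp_add, Real.exp_le_exp]
  have h1 : |g x| ≤ |g 0| + ‖x‖ := by
    have h2 := hlip x 0
    have h3 := abs_sub_abs_le_abs_sub (g x) (g 0)
    rw [sub_zero] at h2
    linarith
  have h4 : t * g x ≤ |t| * (|g 0| + ‖x‖) :=
    (le_abs_self _).trans (by rw [abs_mul]; gcongr)
  have h5 : |t| * ‖x‖ ≤ t ^ 2 / (4 * C) + C * ‖x‖ ^ 2 := by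
    rw [← sq_abs t, div_add' _ _ _ (by positivity), le_div_iff₀ (by positivity)]
    nlinarith [sq_nonneg (|t| - 2 * C * ‖x‖)]
  linarith

/-- For a `1`-Lipschitz function `g`, the function `q ↦ ln ‖e^g‖_q - q / 2` is nonincreasing on the
positive half-line. -/
theorem cgf_div_le_cgf_div_add {n : ℕ} {g : EuclideanSpace ℝ (Fin n) → ℝ}
    (hg : Continuous g) (hlip : ∀ x y, |g x - g y| ≤ ‖x - y‖) {p q : ℝ} (hp : 0 < p) (hpq : p < q) :
    cgf g (stdGaussian (EuclideanSpace ℝ (Fin n))) q / q ≤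
      cgf g (stdGaussian (EuclideanSpace ℝ (Fin n))) p / p + (q - p) / 2 := by
  set γ := stdGaussian (EuclideanSpace ℝ (Fin n))
  have hq : 0 < q := hp.trans hpq
  have hqp : 0 < q - p := by linarith
  -- With `a = p / q` the cost constant is `p / (2 (q - p))`; the factor in `H` pays for completing
  -- the square in `‖x - z‖`.
  have hPL := transportPL_stdGaussian (div_pos hp hq) ((div_lt_one hq).2 hpq) n
    (fun x => ENNReal.ofReal (Real.exp (q * g x)))
    (fun z => ENNReal.ofReal (Real.exp (p * (q - p) / 2) * Real.exp (p * g z)))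
    (by fun_prop) (by fun_prop) (fun x z => by
      rw [ENNReal.ofReal_rpow_of_pos (Real.exp_pos _), ← Real.exp_mul,
        ← ENNReal.ofReal_mul (Real.exp_nonneg _), ← Real.exp_add, ← Real.exp_add]
      refine ENNReal.ofReal_le_ofReal (Real.exp_le_exp.2 ?_)
      have e1 : q * g x * (p / q) = p * g x := by field_simp
      have e2 : p / q / (2 * (1 - p / q)) = p / (2 * (q - p)) := by field_simp
      rw [e1, e2]
      have h1 : g x ≤ g z + ‖x - z‖ := by linarith [(abs_le.1 (hlip x z)).2]
      have h2 : ‖x - z‖ ≤ ‖x - z‖ ^ 2 / (2 * (q - p)) + (q - p) / 2 := by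
        rw [div_add_div _ _ (by positivity) (by norm_num), le_div_iff₀ (by positivity)]
        nlinarith [sq_nonneg (‖x - z‖ - (q - p))]
      have h3 := mul_le_mul_of_nonneg_left (h1.trans (add_le_add_right h2 _)) hp.le
      refine h3.trans_eq ?_
      ring)
  rw [← ofReal_integral_eq_lintegral_ofReal (integrable_exp_mul_of_lipschitz hg hlip q)
      (Filter.Eventually.of_forall fun x => Real.exp_nonneg _),
    ← ofReal_integral_eq_lintegral_ofReal
      ((integrable_exp_mul_of_lipschitz hg hlip p).const_mul _)
      (Filter.Eventually.of_forall fun x => by positivity), integral_const_mul] at hPL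
  change ENNReal.ofReal (mgf g γ q) ^ (p / q) ≤
    ENNReal.ofReal (Real.exp (p * (q - p) / 2) * mgf g γ p) at hPL
  have hposq : 0 < mgf g γ q := mgf_pos (integrable_exp_mul_of_lipschitz hg hlip q)
  have hposp : 0 < mgf g γ p := mgf_pos (integrable_exp_mul_of_lipschitz hg hlip p)
  rw [ENNReal.ofReal_rpow_of_pos hposq, ENNReal.ofReal_le_ofReal_iff (by positivity)] at hPL
  have hlog := Real.log_le_log (by positivity) hPL
  rw [Real.log_rpow hposq, Real.log_mul (Real.exp_ne_zero _) hposp.ne', Real.log_exp] at hlog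
  change p / q * cgf g γ q ≤ p * (q - p) / 2 + cgf g γ p at hlog
  have := div_le_div_of_nonneg_right hlog hp.le
  calc cgf g γ q / q = p / q * cgf g γ q / p := by field_simp
    _ ≤ _ := this
    _ = _ := by field_simp; ring

theorem zero_mem_interior_integrableExpSet_of_lipschitz {n : ℕ}
    {g : EuclideanSpace ℝ (Fin n) → ℝ}
    (hg : Continuous g) (hlip : ∀ x y, |g x - g y| ≤ ‖x - y‖) :
    0 ∈ interior (integrableExpSet g (stdGaussian (EuclideanSpace ℝ (Fin n)))) := by
  have : integrableExpSet g (stdGaussian (EuclideanSpace ℝ (Fin n))) = Set.univ :=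
    Set.eq_univ_of_forall fun t => integrable_exp_mul_of_lipschitz hg hlip t
  simp [this]

/-- The limit `p → 0+` of the previous bound, since `cgf p / p` tends to the derivative of `cgf` at
`0`, the mean of `g`. -/
theorem cgf_div_le_integral_add {n : ℕ} {g : EuclideanSpace ℝ (Fin n) → ℝ}
    (hg : Continuous g) (hlip : ∀ x y, |g x - g y| ≤ ‖x - y‖) {q : ℝ} (hq : 0 < q) :
    cgf g (stdGaussian (EuclideanSpace ℝ (Fin n))) q / q ≤
      (∫ x, g x ∂stdGaussian (EuclideanSpace ℝ (Fin n))) + q / 2 := by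
  set γ := stdGaussian (EuclideanSpace ℝ (Fin n))
  have h0 := zero_mem_interior_integrableExpSet_of_lipschitz hg hlip
  have hd : HasDerivAt (cgf g γ) (∫ x, g x ∂γ) 0 := by
    have h := (analyticAt_cgf h0).differentiableAt.hasDerivAt
    rwa [deriv_cgf_zero h0, probReal_univ, div_one] at h
  have hlim : Filter.Tendsto (fun p => cgf g γ p / p + (q - p) / 2) (nhdsWithin 0 (Set.Ioi 0))
      (nhds ((∫ x, g x ∂γ) + q / 2)) := by
    refine Filter.Tendsto.add ?_ ?_
    · have h := (hasDerivAt_iff_tendsto_slope.1 hd).mono_left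
        (nhdsWithin_mono 0 fun x (hx : 0 < x) => hx.ne')
      refine h.congr fun p => ?_
      simp [slope_def_field]
    · have : Continuous fun p : ℝ => (q - p) / 2 := by fun_prop
      simpa using (this.tendsto 0).mono_left nhdsWithin_le_nhds
  refine ge_of_tendsto hlim ?_
  filter_upwards [Ioo_mem_nhdsGT hq] with p hp
  exact cgf_div_le_cgf_div_add hg hlip hp.1 hp.2

/-- The factor `p` lets `p = 0` be included: both sides vanish there. -/
theorem mul_log_pNorm_exp {E : Type*} [MeasurableSpace E] {μ : Measure E} {g : E → ℝ} {p : ℝ}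
    [IsProbabilityMeasure μ] (h : Integrable (fun x => Real.exp (p * g x)) μ) :
    p * Real.log (pNorm μ p fun x => Real.exp (g x)) = cgf g μ p := by
  by_cases hp : p = 0
  · simp [hp]
  · have e : ∀ x, Real.exp (g x) ^ p = Real.exp (p * g x) := fun x => by
      rw [← Real.exp_mul, mul_comm]
    simp only [pNorm, hp, if_false, e]
    change p * Real.log (mgf g μ p ^ (1 / p)) = _
    rw [Real.log_rpow (mgf_pos h), ← mul_assoc, mul_one_div_cancel hp, one_mul]
    rfl

/-- For a `1`-Lipschitz function `g`, the function `q ↦ ln ‖e^g‖_q - q / 2` is nonincreasing on the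
closed half-line. -/
theorem cgf_le_mul_log_pNorm_add {n : ℕ} {g : EuclideanSpace ℝ (Fin n) → ℝ}
    (hg : Continuous g) (hlip : ∀ x y, |g x - g y| ≤ ‖x - y‖) {p q : ℝ} (hp : 0 ≤ p) (hpq : p ≤ q) :
    cgf g (stdGaussian (EuclideanSpace ℝ (Fin n))) q ≤
      q * (Real.log (pNorm (stdGaussian (EuclideanSpace ℝ (Fin n))) p fun x => Real.exp (g x)) +
        (q - p) / 2) := by
  have hint := integrable_exp_mul_of_lipschitz hg hlip
  rcases hpq.eq_or_lt with rfl | hlt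
  · rw [sub_self, zero_div, add_zero, mul_log_pNorm_exp (hint p)]
  have hq : 0 < q := hp.trans_lt hlt
  rw [← div_le_iff₀' hq]
  rcases hp.eq_or_lt with rfl | hp
  · simpa [pNorm] using cgf_div_le_integral_add hg hlip hq
  · refine (cgf_div_le_cgf_div_add hg hlip hp hlt).trans_eq ?_
    rw [← mul_log_pNorm_exp (hint p), mul_div_cancel_left₀ _ hp.ne']

/-! ### The tail bound. -/

theorem corollary1 {Ω : Type*} [MeasurableSpace Ω] (P : Measure Ω) [IsProbabilityMeasure P]
    (n : ℕ) (X : Ω → EuclideanSpace ℝ (Fin n))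
    (hX : HasLaw X (stdGaussian (EuclideanSpace ℝ (Fin n))) P)
    (g : EuclideanSpace ℝ (Fin n) → ℝ) (hg : Differentiable ℝ g)
    (hgrad : ∀ᵐ ω ∂P, ‖gradient g (X ω)‖ ≤ 1)
    (p : ℝ) (hp : 0 ≤ p) :
    -- the expectations that define `‖e^g‖_p` (for `p = 0` and for `p > 0`) exist and are finite
    Integrable g (stdGaussian (EuclideanSpace ℝ (Fin n))) ∧
    Integrable (fun x => Real.exp (g x) ^ p) (stdGaussian (EuclideanSpace ℝ (Fin n))) ∧
    -- the tail bound
    ∀ r : ℝ,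
      P.real {ω | r ≤ g (X ω) - Real.log
          (pNorm (stdGaussian (EuclideanSpace ℝ (Fin n))) p (fun x => Real.exp (g x)))} ≤
        if p / 2 ≤ r then Real.exp (-(1 / 2) * (r + p / 2) ^ 2) else Real.exp (-p * r) := by
  have hcont := hg.continuous
  have hgrad' : ∀ᵐ x ∂stdGaussian (EuclideanSpace ℝ (Fin n)), ‖gradient g x‖ ≤ 1 := by
    have hmeas : MeasurableSet {x | ‖gradient g x‖ ≤ 1} := by
      have hnorm : ∀ z, ‖gradient g z‖ = ‖fderiv ℝ g z‖ := fun z => by simp [gradient]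
      simp only [hnorm]
      exact measurableSet_le (measurable_fderiv ℝ g).norm measurable_const
    rw [← hX.map_eq, ae_map_iff hX.aemeasurable hmeas]
    exact hgrad
  have hlip := abs_sub_le_norm_of_ae_norm_gradient_le_one hg
    ((volume_absolutelyContinuous_stdGaussian n).ae_le hgrad')
  have hint := integrable_exp_mul_of_lipschitz hcont hlip
  refine ⟨?_, ?_, fun r => ?_⟩
  · simpa using integrable_pow_of_mem_interior_integrableExpSet
      (zero_mem_interior_integrableExpSet_of_lipschitz hcont hlip) 1
  · refine (hint p).congr (Filter.Eventually.of_forall fun x => ?_)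
    simp only [← Real.exp_mul, mul_comm]
  · set N := Real.log
      (pNorm (stdGaussian (EuclideanSpace ℝ (Fin n))) p fun x => Real.exp (g x)) with hN
    have hset : P.real {ω | r ≤ g (X ω) - N} =
        (stdGaussian (EuclideanSpace ℝ (Fin n))).real {x | r + N ≤ g x} := by
      simp only [le_sub_iff_add_le, Measure.real]
      rw [hX.measure_eq (p := fun x => r + N ≤ g x)
        (measurableSet_le measurable_const hcont.measurable)]
    rw [hset]
    split_ifs with hr
    -- Chernoff at the free minimiser `q = r + p / 2`, admissible because `r ≥ p / 2`; otherwise `q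
    -- = p` is used.
    · have hq : p ≤ r + p / 2 := by linarith
      refine (measure_ge_le_exp_cgf (r + N) (hp.trans hq) (hint _)).trans (Real.exp_le_exp.2 ?_)
      have := cgf_le_mul_log_pNorm_add hcont hlip hp hq
      rw [← hN] at this
      linarith
    · refine (measure_ge_le_exp_cgf (r + N) hp (hint _)).trans (Real.exp_le_exp.2 ?_)
      rw [← mul_log_pNorm_exp (hint p), ← hN]
      linarith
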